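/- Sequence Datalog. Fix a countably infinite set $\mathbf{dom}$ of atomic values. Values and paths are defined by mutual recursion: atomic values are values, paths are finite sequences of values, and for every path $p$ the packed value $\langle p\rangle$ is a value. A schema is a finite set of relation names with arities; it is monadic if all arities are at most one. An instance of a schema assigns to each of its relation names a finite relation (of the right arity) on paths; it is flat if no packed values occur in it. Path expressions are built like paths, from atomic values, atomic variables $@x$ (ranging over $\mathbf{dom}$) and path variables $\$x$ (ranging over paths). A program is a finite sequence of strata, each a finite set of safe rules $H \leftarrow B$, where the head $H$ is a predicate $P(e_1,\dots,e_n)$ on path expressions and the body $B$ is a finite set of predicates, equations $e_1=e_2$ between path expressions, and negations of these; negation is stratified: if a negated predicate $\neg P(\dots)$ occurs in a stratum, no rule of that or a later stratum has $P$ in its head. A rule is safe if all its variables are limited, where the limited variables are the least set that contains the variables of the positive predicates in the body and that, if it contains all variables of one side of a positive equation in the body, contains those of the other side. Semantics is the usual stratum-by-stratum least (finite) model; if some stratum has no finite model, the program does not terminate on that input. IDB relation names are those used in heads; the other relation names of the program are EDB. A program is over a schema $\Gamma$ if its EDB names belong to $\Gamma$ and its IDB names do not. The features of programs are: $\mathsf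 A$ (a predicate of arity greater than one occurs), $\mathsf R$ (the dependency graph on IDB names has a cycle), $\mathsf E$ (an equation occurs, negated or not), $\mathsf N$ (a negated atom occurs), $\mathsf P$ (a packed expression $\langle e\rangle$ occurs), $\mathsf I$ (there are at least two different IDB names). Let $\Phi=\{\mathsf A,\mathsf E,\mathsf I,\mathsf N,\mathsf P,\mathsf R\}$. A program belongs to a fragment $F\subseteq\Phi$ if it uses only features from $F$. For a monadic schema $\Gamma$ and a relation name $S\notin\Gamma$ of arity at most one, a query from $\Gamma$ to $S$ is a total mapping $Q$ from flat instances of $\Gamma$ to flat instances of $\{S\}$; a program $\mathbf P$ computes $Q$ if it is over $\Gamma$, terminates on every flat instance of $\Gamma$, has $S$ as an IDB name, and satisfies $\mathbf P(I)(S)=Q(I)$ for every flat instance $I$ of $\Gamma$. Write $F_1\le F_2$ if every query computable by a program in $F_1$ is computable by a program in $F_2$. Theorem. $\mathsf I$ is primitive in the presence of $\mathsf N$, that is, $\{\mathsf I,\mathsf N\}\not\le\Phi\setminus\{\mathsf I\}$. Specifically, let $R$, $B$ and $S$ be unary, and let $Q$ be the query from $\{R,B\}$ to $S$ that, viewing the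 paths $x\cdot y$ in $R$ with $x,y\in\mathbf{dom}$ as the edges of a directed graph and the atomic values in $B$ as the black nodes, returns the nodes that have at least one outgoing edge and all of whose out-neighbours are black: $$Q(I)(S)=\{x\in\mathbf{dom} \mid \exists y\in\mathbf{dom}:\ x\cdot y\in I(R),\ \text{and}\ \forall y\in\mathbf{dom}:\ x\cdot y\in I(R)\Rightarrow y\in I(B)\}.$$ Then $Q$ is computable by a program in the fragment $\{\mathsf I,\mathsf N\}$, but by no program in the fragment $\Phi\setminus\{\mathsf I\}$. -/

import Mathlib

namespace SeqDatalog

/-! ### Data model -/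

/-- Values over a universe `D` of atomic values: an atomic value `a`, or a packed value `⟨p⟩`
where the path `p` is a finite sequence of values. -/
inductive Value (D : Type*) where
  | atom (a : D) : Value D
  | pack (p : List (Value D)) : Value D

/-- Paths are finite sequences of values; `[]` is the empty path, `++` is concatenation, and a
value `v` is identified with the one-element path `[v]`. -/
abbrev Path (D : Type*) := List (Value D)

/-- A path is flat if no packed value occurs in it. -/
def Path.IsFlat {D : Type*} (p : Path D) : Prop := ∀ v ∈ p, ∃ a : D, v = Value.atom a

/-- Relation names, each with its arity; there are infinitely many names of every arity. -/
structure RelName where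
  id : ℕ
  arity : ℕ
deriving DecidableEq

/-- A schema is a finite set of relation names. -/
abbrev Schema := Finset RelName

/-- A schema is monadic if its relation names have arity zero or one. -/
def Schema.IsMonadic (Γ : Schema) : Prop := ∀ R ∈ Γ, R.arity ≤ 1

/-- A fact `R(p₁, …, pₙ)`. -/
structure Fact (D : Type*) where
  rel : RelName
  args : Fin rel.arity → Path D

/-- A flat instance of the schema `Γ`, viewed as a finite set of facts. -/
structure FlatInstance (D : Type*) (Γ : Schema) where
  facts : Set (Fact D)
  finite : facts.Finite
  rel_mem : ∀ f ∈ facts, f.rel ∈ Γ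
  flat : ∀ f ∈ facts, ∀ i, Path.IsFlat (f.args i)

/-! ### Syntax -/

/-- Variables: atomic variables `@x` and path variables `$x`. -/
inductive Var where
  | atomic (x : ℕ) : Var
  | path (x : ℕ) : Var

/-- The elements of path expressions: atomic values, variables and packed path expressions. -/
inductive Item (D : Type*) where
  | const (a : D) : Item D
  | var (x : Var) : Item D
  | pack (e : List (Item D)) : Item D

/-- Path expressions are finite sequences of items. -/
abbrev PathExpr (D : Type*) := List (Item D)

mutual
/-- The variables occurring in an item. -/
def Item.vars {D : Type*} : Item D → Set Var
  | .const _ => ∅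
  | .var x => {x}
  | .pack e => PathExpr.vars e
/-- The variables occurring in a path expression. -/
def PathExpr.vars {D : Type*} : List (Item D) → Set Var
  | [] => ∅
  | t :: e => Item.vars t ∪ PathExpr.vars e
end

/-- Atoms: predicates `R(e₁, …, eₙ)` and equations `e₁ = e₂`. -/
inductive Atom (D : Type*) where
  | pred (R : RelName) (args : Fin R.arity → PathExpr D) : Atom D
  | eqn (e₁ e₂ : PathExpr D) : Atom D

/-- The path expressions that are the components of an atom. -/
def Atom.exprs {D : Type*} : Atom D → Set (PathExpr D)
  | .pred _ args => Set.range args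
  | .eqn e₁ e₂ => {e₁, e₂}

/-- Literals: atoms and negated atoms. -/
inductive Literal (D : Type*) where
  | pos (A : Atom D) : Literal D
  | neg (A : Atom D) : Literal D

/-- The atom underlying a literal. -/
def Literal.atom {D : Type*} : Literal D → Atom D
  | .pos A => A
  | .neg A => A

/-- A rule `H ← B`; the head `H` is the predicate `headRel(headArgs)` and the body `B` is a finite
set of literals. -/
structure Rule (D : Type*) where
  headRel : RelName
  headArgs : Fin headRel.arity → PathExpr D
  body : Finset (Literal D)

namespace Rule

variable {D : Type*}

/-- The atoms of a rule: its head and the atoms occurring, negated or not, in its body. -/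
def atoms (r : Rule D) : Set (Atom D) :=
  {A | A = .pred r.headRel r.headArgs ∨ ∃ L ∈ r.body, L.atom = A}

/-- The path expressions that are components of atoms of the rule. -/
def exprs (r : Rule D) : Set (PathExpr D) := {e | ∃ A ∈ r.atoms, e ∈ A.exprs}

/-- The variables occurring in a rule. -/
def vars (r : Rule D) : Set Var := {x | ∃ e ∈ r.exprs, x ∈ PathExpr.vars e}

/-- The limited variables of a rule. -/
inductive Limited (r : Rule D) : Var → Prop
  | pred {R : RelName} {args : Fin R.arity → PathExpr D} (i : Fin R.arity) {x : Var}
      (hL : Literal.pos (.pred R args) ∈ r.body) (hx : x ∈ PathExpr.vars (args i)) : Limited r x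
  | eqnRight {e₁ e₂ : PathExpr D} {x : Var} (hL : Literal.pos (.eqn e₁ e₂) ∈ r.body)
      (h : ∀ y ∈ PathExpr.vars e₁, Limited r y) (hx : x ∈ PathExpr.vars e₂) : Limited r x
  | eqnLeft {e₁ e₂ : PathExpr D} {x : Var} (hL : Literal.pos (.eqn e₁ e₂) ∈ r.body)
      (h : ∀ y ∈ PathExpr.vars e₂, Limited r y) (hx : x ∈ PathExpr.vars e₁) : Limited r x

/-- A rule is safe if all its variables are limited. -/
def IsSafe (r : Rule D) : Prop := ∀ x ∈ r.vars, r.Limited x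

end Rule

/-- A program is a finite sequence of strata, which are finite sets of safe rules, such that
negation is stratified: if `¬ R(…)` occurs in a stratum, then `R` is not used in the head of a
rule of that stratum or of a later one. -/
structure Program (D : Type*) where
  strata : List (Finset (Rule D))
  safe : ∀ σ ∈ strata, ∀ r ∈ σ, r.IsSafe
  stratified : ∀ i j : Fin strata.length, i ≤ j →
    ∀ r ∈ strata.get i, ∀ (R : RelName) (args : Fin R.arity → PathExpr D),
      Literal.neg (.pred R args) ∈ r.body → ∀ r' ∈ strata.get j, r'.headRel ≠ R

/-! ### Semantics -/

/-- A valuation maps atomic variables to atomic values and path variables to paths. -/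
structure Valuation (D : Type*) where
  atomic : ℕ → D
  path : ℕ → Path D

/-- The path assigned to a variable by a valuation. -/
def Valuation.onVar {D : Type*} (ν : Valuation D) : Var → Path D
  | .atomic x => [Value.atom (ν.atomic x)]
  | .path x => ν.path x

mutual
/-- Application of a valuation to an item. -/
def Item.eval {D : Type*} (ν : Valuation D) : Item D → List (Value D)
  | .const a => [Value.atom a]
  | .var x => ν.onVar x
  | .pack e => [Value.pack (PathExpr.eval ν e)]
/-- Application of a valuation to a path expression. -/
def PathExpr.eval {D : Type*} (ν : Valuation D) : List (Item D) → List (Value D)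
  | [] => []
  | t :: e => Item.eval ν t ++ PathExpr.eval ν e
end

/-- `I, ν` satisfies the atom. -/
def Atom.Holds {D : Type*} (I : Set (Fact D)) (ν : Valuation D) : Atom D → Prop
  | .pred R args => (⟨R, fun i => PathExpr.eval ν (args i)⟩ : Fact D) ∈ I
  | .eqn e₁ e₂ => PathExpr.eval ν e₁ = PathExpr.eval ν e₂

/-- `I, ν` satisfies the literal. -/
def Literal.Holds {D : Type*} (I : Set (Fact D)) (ν : Valuation D) : Literal D → Prop
  | .pos A => A.Holds I ν
  | .neg A => ¬ A.Holds I ν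

/-- The rule is satisfied in `I`. -/
def Rule.SatisfiedIn {D : Type*} (r : Rule D) (I : Set (Fact D)) : Prop :=
  ∀ ν : Valuation D, (∀ L ∈ r.body, L.Holds I ν) →
    (Atom.pred r.headRel r.headArgs).Holds I ν

/-- `K` is the result of applying the stratum `σ` to the instance `J`: the smallest (finite)
instance that contains `J`, agrees with `J` on the relation names that are not used in heads of
`σ`, and satisfies all rules of `σ`. -/
def IsStratumResult {D : Type*} (σ : Finset (Rule D)) (J K : Set (Fact D)) : Prop :=
  IsLeast {M : Set (Fact D) | M.Finite ∧ J ⊆ M ∧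
    (∀ f ∈ M, (∀ r ∈ σ, r.headRel ≠ f.rel) → f ∈ J) ∧ ∀ r ∈ σ, r.SatisfiedIn M} K

/-- `K` is the result of applying a sequence of strata, one after the other, to `J`. -/
def IsStrataResult {D : Type*} : List (Finset (Rule D)) → Set (Fact D) → Set (Fact D) → Prop
  | [], J, K => K = J
  | σ :: τ, J, K => ∃ M, IsStratumResult σ J M ∧ IsStrataResult τ M K

namespace Program

variable {D : Type*}

/-- The rules of a program. -/
def rules (P : Program D) : Set (Rule D) := {r | ∃ σ ∈ P.strata, r ∈ σ}

/-- The IDB relation names: those used in the head of some rule. -/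
def idb (P : Program D) : Set RelName := {R | ∃ r ∈ P.rules, r.headRel = R}

/-- The relation names occurring in a program. -/
def relNames (P : Program D) : Set RelName :=
  {R | ∃ r ∈ P.rules, ∃ args, Atom.pred R args ∈ r.atoms}

/-- The EDB relation names: those that occur in the program and are not IDB. -/
def edb (P : Program D) : Set RelName := P.relNames \ P.idb

/-- The program is over the schema `Γ`: its EDB relation names belong to `Γ` and its IDB relation
names do not. -/
def IsOver (P : Program D) (Γ : Schema) : Prop :=
  (∀ R ∈ P.edb, R ∈ Γ) ∧ ∀ R ∈ P.idb, R ∉ Γ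

/-- `K` is the result `P(J)`. -/
def IsResult (P : Program D) (J K : Set (Fact D)) : Prop := IsStrataResult P.strata J K

/-- The program terminates on `J`, i.e., `P(J)` is defined. -/
def TerminatesOn (P : Program D) (J : Set (Fact D)) : Prop := ∃ K, P.IsResult J K

/-- The edges of the dependency graph on the IDB relation names. -/
def DependsOn (P : Program D) (R₁ R₂ : RelName) : Prop :=
  R₁ ∈ P.idb ∧ R₂ ∈ P.idb ∧
    ∃ r ∈ P.rules, r.headRel = R₁ ∧ ∃ L ∈ r.body, ∃ args, L.atom = .pred R₂ args

end Program

/-! ### Features, fragments and queries -/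

/-- The six features: `A`, `R`, `E`, `N`, `P`, `I`. -/
inductive Feature where
  | arity
  | recursion
  | equations
  | negation
  | packing
  | intermediate

/-- The program uses the given feature. -/
def Program.Uses {D : Type*} (P : Program D) : Feature → Prop
  | .arity => ∃ R ∈ P.relNames, 1 < R.arity
  | .recursion => ∃ R, Relation.TransGen P.DependsOn R R
  | .equations => ∃ r ∈ P.rules, ∃ L ∈ r.body, ∃ e₁ e₂, L.atom = .eqn e₁ e₂
  | .negation => ∃ r ∈ P.rules, ∃ A, Literal.neg A ∈ r.body
  | .packing => ∃ r ∈ P.rules, ∃ e ∈ r.exprs, ∃ e', Item.pack e' ∈ e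
  | .intermediate => ∃ R₁ ∈ P.idb, ∃ R₂ ∈ P.idb, R₁ ≠ R₂

/-- A fragment is a set of features; `Set.univ` is the set of all features. -/
abbrev Fragment := Set Feature

/-- The program belongs to the fragment. -/
def Program.InFragment {D : Type*} (P : Program D) (F : Fragment) : Prop :=
  ∀ X, P.Uses X → X ∈ F

/-- Queries from `Γ` to `S`: total mappings from flat instances of `Γ` to flat instances
of `{S}`. -/
abbrev Query (D : Type*) (Γ : Schema) (S : RelName) := FlatInstance D Γ → FlatInstance D {S}

/-- The program computes the query. -/
def Program.Computes {D : Type*} (P : Program D) {Γ : Schema} {S : RelName}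
    (Q : Query D Γ S) : Prop :=
  P.IsOver Γ ∧
  (∀ I : FlatInstance D Γ, P.TerminatesOn I.facts) ∧
  S ∈ P.idb ∧
  ∀ (I : FlatInstance D Γ) (K : Set (Fact D)), P.IsResult I.facts K →
    {f ∈ K | f.rel = S} = (Q I).facts

/-- The query is computable by a program in the fragment `F`. -/
def Query.ComputableIn {D : Type*} {Γ : Schema} {S : RelName} (Q : Query D Γ S)
    (F : Fragment) : Prop :=
  ∃ P : Program D, P.InFragment F ∧ P.Computes Q

/-- Fragment `F₁` is subsumed by fragment `F₂` (for the universe `D` of atomic values). -/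
def Subsumed (D : Type*) (F₁ F₂ : Fragment) : Prop :=
  ∀ (Γ : Schema) (S : RelName), Γ.IsMonadic → S ∉ Γ → S.arity ≤ 1 →
    ∀ Q : Query D Γ S, Query.ComputableIn Q F₁ → Query.ComputableIn Q F₂

/-- Feature `X` is primitive in the presence of the set of features `Y`. -/
def PrimitiveInPresence (D : Type*) (X : Feature) (Y : Set Feature) : Prop :=
  ¬ Subsumed D ({X} ∪ Y) (Set.univ \ {X})

/-! ### The query -/

/-- The unary relation name `R`, whose paths `x·y` of length two are the edges of a graph. -/
def relR : RelName := ⟨0, 1⟩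

/-- The unary relation name `B`, whose atomic values are the black nodes. -/
def relB : RelName := ⟨1, 1⟩

/-- The unary output relation name `S`. -/
def relS : RelName := ⟨2, 1⟩

/-- The fact `R(x·y)`. -/
def edgeFact {D : Type*} (x y : D) : Fact D := ⟨relR, fun _ => [.atom x, .atom y]⟩

/-- The fact `B(y)`. -/
def blackFact {D : Type*} (y : D) : Fact D := ⟨relB, fun _ => [.atom y]⟩

/-- The fact `S(x)`. -/
def outFact {D : Type*} (x : D) : Fact D := ⟨relS, fun _ => [.atom x]⟩

/-- The query from `{R, B}` to `S` that returns the nodes with an outgoing edge, all of whose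
out-neighbours are black. -/
def allBlackQuery (D : Type*) : Query D {relR, relB} relS := fun I =>
  { facts := {f | ∃ x : D, f = outFact x ∧ (∃ y, edgeFact x y ∈ I.facts) ∧
      ∀ y, edgeFact x y ∈ I.facts → blackFact y ∈ I.facts}
    finite := by
      refine (I.finite.image (fun f : Fact D => (⟨relS, fun _ =>
        if h : 0 < f.rel.arity then (f.args ⟨0, h⟩).take 1 else []⟩ : Fact D))).subset ?_
      rintro f ⟨x, rfl, ⟨y, hy⟩, -⟩
      exact ⟨_, hy, by simp [edgeFact, outFact, relR]⟩
    rel_mem := by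
      rintro f ⟨x, rfl, -⟩
      simp [outFact]
    flat := by
      rintro f ⟨x, rfl, -⟩ i v hv
      exact ⟨x, by simpa [outFact] using hv⟩ }

end SeqDatalog

-- Positive part: two strata suffice. An intermediate name collects the nodes with a non-black
-- out-neighbour, and the second stratum returns the sources of edges outside that set.
--
-- Negative part: if the only IDB name is the output name, stratification forbids negating it, so
-- negation can only test the input (`Program.headRel_ne_of_neg_mem`). Hence a rule that fires on
-- the bare input contributes its head to the final result, whatever its stratum
-- (`IsStrataResult.head_mem`). Take a star with more leaves than any body has literals, all of them
-- black. Its centre must be returned, so some rule fires on the input: otherwise the input would be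
-- its own result (`isStrataResult_self`). Under a fixed valuation each literal inspects at most one
-- fact, so some leaf's colour is never used positively. Making that leaf white keeps the rule
-- firing (`exists_holds_star_erase`), yet the correct output is now empty.

namespace SeqDatalog

variable {D : Type*}

/-! ### Literals and rules on instances that agree on some relation names -/

theorem Literal.holds_congr {L : Literal D} {J M : Set (Fact D)} {ν : Valuation D}
    (h : ∀ R args, L.atom = .pred R args → ∀ f : Fact D, f.rel = R → (f ∈ M ↔ f ∈ J)) :
    L.Holds M ν ↔ L.Holds J ν := by
  rcases L with (⟨R, args⟩ | ⟨e₁, e₂⟩) | (⟨R, args⟩ | ⟨e₁, e₂⟩)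
  · exact h R args rfl _ rfl
  · exact Iff.rfl
  · exact not_congr (h R args rfl _ rfl)
  · exact Iff.rfl

/-- The facts obtained by applying the rule once to `J`. -/
def Rule.consequences (r : Rule D) (J : Set (Fact D)) : Set (Fact D) :=
  {f | ∃ ν : Valuation D, (∀ L ∈ r.body, L.Holds J ν) ∧
    f = ⟨r.headRel, fun i => PathExpr.eval ν (r.headArgs i)⟩}

/-- A stratum that consists of one nonrecursive rule adds the immediate consequences. -/
theorem isStratumResult_singleton {r : Rule D} {J : Set (Fact D)} (hJ : J.Finite)
    (hfin : (r.consequences J).Finite)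
    (hr : ∀ L ∈ r.body, ∀ R args, L.atom = .pred R args → R ≠ r.headRel) :
    IsStratumResult {r} J (J ∪ r.consequences J) := by
  -- Since the body avoids the head's name, every admissible instance evaluates it as `J` does; one
  -- application of the rule is then already closed.
  have key : ∀ M : Set (Fact D), J ⊆ M → (∀ f ∈ M, r.headRel ≠ f.rel → f ∈ J) →
      ∀ ν : Valuation D, ∀ L ∈ r.body, (L.Holds M ν ↔ L.Holds J ν) := by
    intro M hJM hM ν L hL
    refine Literal.holds_congr fun R args hA f hf => ⟨fun h => hM f h ?_, fun h => hJM h⟩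
    exact fun h => hr L hL R args hA (hf.symm.trans h.symm)
  have hagree : ∀ f ∈ J ∪ r.consequences J, r.headRel ≠ f.rel → f ∈ J := by
    rintro f (h | ⟨ν, -, rfl⟩) hne
    · exact h
    · exact absurd rfl hne
  constructor
  · refine ⟨hJ.union hfin, Set.subset_union_left,
      fun f hf h => hagree f hf (h r (Finset.mem_singleton_self r)), ?_⟩
    intro r' hr' ν hν
    obtain rfl := Finset.mem_singleton.1 hr'
    exact Or.inr ⟨ν, fun L hL => (key _ Set.subset_union_left hagree ν L hL).1 (hν L hL), rfl⟩
  · rintro M ⟨-, hJM, hM, hsat⟩ f (hf | ⟨ν, hν, rfl⟩)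
    · exact hJM hf
    · have hM' : ∀ f ∈ M, r.headRel ≠ f.rel → f ∈ J := fun f hf hne =>
        hM f hf fun r' hr' => by rwa [Finset.mem_singleton.1 hr']
      exact hsat r (Finset.mem_singleton_self r) ν
        fun L hL => (key M hJM hM' ν L hL).2 (hν L hL)

-- Results of sequences of strata

theorem IsStrataResult.unique {τ : List (Finset (Rule D))} {J K K' : Set (Fact D)}
    (h : IsStrataResult τ J K) (h' : IsStrataResult τ J K') : K = K' := by
  induction τ generalizing J with
  | nil => exact Eq.trans h (Eq.symm h')
  | cons σ τ ih =>
    obtain ⟨M, hM, h⟩ := h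
    obtain ⟨M', hM', h'⟩ := h'
    obtain rfl := IsLeast.unique hM hM'
    exact ih h h'

theorem IsStrataResult.subset {τ : List (Finset (Rule D))} {J K : Set (Fact D)}
    (h : IsStrataResult τ J K) : J ⊆ K := by
  induction τ generalizing J with
  | nil => exact (Eq.symm h).subset
  | cons σ τ ih =>
    obtain ⟨M, hM, h⟩ := h
    exact hM.1.2.1.trans (ih h)

/-- An instance that satisfies all rules is not changed. -/
theorem isStrataResult_self {τ : List (Finset (Rule D))} {J : Set (Fact D)} (hJ : J.Finite)
    (h : ∀ σ ∈ τ, ∀ r ∈ σ, r.SatisfiedIn J) : IsStrataResult τ J J := by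
  induction τ with
  | nil => rfl
  | cons σ τ ih =>
    refine ⟨J, ⟨⟨hJ, subset_rfl, fun f hf _ => hf, h σ List.mem_cons_self⟩, fun M hM => hM.2.1⟩,
      ih fun ρ hρ => h ρ (List.mem_cons_of_mem _ hρ)⟩

/-- If a rule fires on the input, and its negated predicates are not used in heads, then its
consequence belongs to the result. -/
theorem IsStrataResult.head_mem {τ : List (Finset (Rule D))} {J K : Set (Fact D)}
    (h : IsStrataResult τ J K) {σ : Finset (Rule D)} (hσ : σ ∈ τ) {r : Rule D} (hr : r ∈ σ)
    (hneg : ∀ R args, Literal.neg (.pred R args) ∈ r.body → ∀ σ' ∈ τ, ∀ r' ∈ σ', r'.headRel ≠ R)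
    {ν : Valuation D} (hν : ∀ L ∈ r.body, L.Holds J ν) :
    (Atom.pred r.headRel r.headArgs).Holds K ν := by
  induction τ generalizing J with
  | nil => simp at hσ
  | cons σ₀ τ ih =>
    obtain ⟨M, ⟨⟨-, hJM, hM, hsat⟩, -⟩, h⟩ := h
    -- Positive literals survive because `M` contains `J`; negated predicates survive because the
    -- stratum cannot add facts to their relations.
    have hνM : ∀ L ∈ r.body, L.Holds M ν := by
      intro L hL
      have hLJ := hν L hL
      rcases L with (⟨R, args⟩ | ⟨e₁, e₂⟩) | (⟨R, args⟩ | ⟨e₁, e₂⟩)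
      · exact hJM hLJ
      · exact hLJ
      · exact fun hmem => hLJ (hM _ hmem fun r' hr' => hneg R args hL σ₀ List.mem_cons_self r' hr')
      · exact hLJ
    rcases List.mem_cons.1 hσ with rfl | hσ
    · exact h.subset (hsat r hr ν hνM)
    · exact ih h hσ (fun R args hL σ' hσ' => hneg R args hL σ' (List.mem_cons_of_mem _ hσ')) hνM

/-- In a program with at most one IDB relation name, no IDB relation name is negated. -/
theorem Program.headRel_ne_of_neg_mem {P : Program D} (hP : ¬ P.Uses .intermediate)
    {r : Rule D} (hr : r ∈ P.rules) {R : RelName} {args : Fin R.arity → PathExpr D}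
    (hL : Literal.neg (.pred R args) ∈ r.body) {r' : Rule D} (hr' : r' ∈ P.rules) :
    r'.headRel ≠ R := by
  have heq : r'.headRel = r.headRel := by
    by_contra hne
    exact hP ⟨_, ⟨r', hr', rfl⟩, _, ⟨r, hr, rfl⟩, hne⟩
  obtain ⟨σ, hσ, hrσ⟩ := hr
  obtain ⟨i, rfl⟩ := List.get_of_mem hσ
  rw [heq]
  -- Stratification is applied to the rule against itself: its own head, the only IDB name, differs
  -- from the names it negates.
  exact P.stratified i i le_rfl r hrσ R args hL r hrσ

/-- Gives a uniform bound on the body sizes, from which the number of leaves is chosen. -/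
theorem Program.finite_rules (P : Program D) : P.rules.Finite := by
  have h : P.rules = ⋃ σ ∈ {σ | σ ∈ P.strata}, (σ : Set (Rule D)) := by
    ext r
    simp [Program.rules]
  rw [h]
  exact P.strata.finite_toSet.biUnion fun σ _ => σ.finite_toSet

/-! ### Star graphs -/

theorem edgeFact_inj {x y x' y' : D} : edgeFact x y = edgeFact x' y' ↔ x = x' ∧ y = y' := by
  constructor
  · intro h
    have h' := congrFun (eq_of_heq (Fact.mk.inj h).2) (⟨0, Nat.one_pos⟩ : Fin 1)
    simpa using h'
  · rintro ⟨rfl, rfl⟩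
    rfl

theorem blackFact_inj {y y' : D} : blackFact y = blackFact y' ↔ y = y' := by
  constructor
  · intro h
    have h' := congrFun (eq_of_heq (Fact.mk.inj h).2) (⟨0, Nat.one_pos⟩ : Fin 1)
    simpa using h'
  · rintro rfl
    rfl

theorem edgeFact_ne_blackFact (x y z : D) : edgeFact x y ≠ blackFact z := by
  intro h
  have := congrArg Fact.rel h
  simp [edgeFact, blackFact, relR, relB] at this

/-- The star with centre `a` and leaves `V`, the black nodes being those in `W`. -/
def star (a : D) (V W : Finset D) : FlatInstance D {relR, relB} where
  facts := edgeFact a '' V ∪ blackFact '' W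
  finite := (V.finite_toSet.image _).union (W.finite_toSet.image _)
  rel_mem := by
    rintro f (⟨y, -, rfl⟩ | ⟨y, -, rfl⟩) <;> simp [edgeFact, blackFact]
  flat := by
    rintro f (⟨y, -, rfl⟩ | ⟨y, -, rfl⟩) i v hv <;> simp [edgeFact, blackFact] at hv
    · rcases hv with rfl | rfl <;> exact ⟨_, rfl⟩
    · exact ⟨y, hv⟩

theorem edgeFact_mem_star {a x y : D} {V W : Finset D} :
    edgeFact x y ∈ (star a V W).facts ↔ x = a ∧ y ∈ V := by
  constructor
  · rintro (⟨z, hz, h⟩ | ⟨z, -, h⟩)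
    · obtain ⟨rfl, rfl⟩ := edgeFact_inj.1 h
      exact ⟨rfl, hz⟩
    · exact absurd h.symm (edgeFact_ne_blackFact x y z)
  · rintro ⟨rfl, hy⟩
    exact Or.inl ⟨y, hy, rfl⟩

theorem blackFact_mem_star {a y : D} {V W : Finset D} :
    blackFact y ∈ (star a V W).facts ↔ y ∈ W := by
  constructor
  · rintro (⟨z, -, h⟩ | ⟨z, hz, h⟩)
    · exact absurd h (edgeFact_ne_blackFact a z y)
    · obtain rfl := blackFact_inj.1 h
      exact hz
  · exact fun hy => Or.inr ⟨y, hy, rfl⟩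

theorem star_facts_mono {a : D} {V W W' : Finset D} (h : W' ⊆ W) :
    (star a V W').facts ⊆ (star a V W).facts :=
  Set.union_subset_union_right _ (Set.image_mono (Finset.coe_subset.2 h))

/-- Only the centre has outgoing edges, and the white leaf `b` disqualifies it. -/
theorem allBlackQuery_star_eq_empty {a b : D} {V W : Finset D} (hb : b ∈ V) (hbW : b ∉ W) :
    (allBlackQuery D (star a V W)).facts = ∅ := by
  refine Set.eq_empty_of_forall_notMem ?_
  rintro f ⟨x, -, ⟨y, hy⟩, hall⟩
  obtain ⟨rfl, -⟩ := edgeFact_mem_star.1 hy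
  exact hbW (blackFact_mem_star.1 (hall b (edgeFact_mem_star.2 ⟨rfl, hb⟩)))

theorem outFact_mem_allBlackQuery_star {a : D} {V : Finset D} (hV : V.Nonempty) :
    outFact a ∈ (allBlackQuery D (star a V V)).facts := by
  obtain ⟨b, hb⟩ := hV
  exact ⟨a, rfl, ⟨b, edgeFact_mem_star.2 ⟨rfl, hb⟩⟩,
    fun y hy => blackFact_mem_star.2 (edgeFact_mem_star.1 hy).2⟩

/-- A rule that fires on a star all of whose leaves are black still fires if some leaf loses its
colour, provided that there are more leaves than literals. -/
theorem exists_holds_star_erase [DecidableEq D] {a : D} {V : Finset D} {r : Rule D}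
    {ν : Valuation D} (hcard : r.body.card < V.card)
    (hν : ∀ L ∈ r.body, L.Holds (star a V V).facts ν) :
    ∃ b ∈ V, ∀ L ∈ r.body, L.Holds (star a V (V.erase b)).facts ν := by
  by_contra! hcon
  -- If whitening `b` breaks the rule, the culprit is a positive predicate instantiated to exactly
  -- `blackFact b`: equations ignore the instance, and removing facts cannot falsify a negated
  -- predicate.
  have hfact : ∀ b ∈ V, ∃ L ∈ r.body, ∃ (R : RelName) (args : Fin R.arity → PathExpr D),
      L = .pos (.pred R args) ∧
        (⟨R, fun i => PathExpr.eval ν (args i)⟩ : Fact D) = blackFact b := by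
    intro b hb
    obtain ⟨L, hL, hnot⟩ := hcon b hb
    refine ⟨L, hL, ?_⟩
    have hI := hν L hL
    rcases L with (⟨R, args⟩ | ⟨e₁, e₂⟩) | (⟨R, args⟩ | ⟨e₁, e₂⟩)
    · refine ⟨R, args, rfl, ?_⟩
      rcases hI with hI | ⟨y, hy, hI⟩
      · exact absurd (Or.inl hI) hnot
      · rw [← hI]
        by_contra hne
        refine hnot (Or.inr ⟨y, ?_, hI⟩)
        exact Finset.mem_coe.2 (Finset.mem_erase.2 ⟨fun h => hne (by rw [h]), hy⟩)
    · exact absurd hI hnot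
    · exact absurd (fun h => hI (star_facts_mono (Finset.erase_subset b V) h)) hnot
    · exact absurd hI hnot
  have : Nonempty (Literal D) := ⟨.pos (.eqn [] [])⟩
  choose! g hg hgeq using hfact
  -- Pigeonhole: two distinct leaves would share a literal, which under the single valuation `ν`
  -- denotes only one fact.
  obtain ⟨b, hb, b', hb', hne, heq⟩ := Finset.exists_ne_map_eq_of_card_lt_of_maps_to hcard hg
  obtain ⟨R, args, h₁, h₂⟩ := hgeq b hb
  obtain ⟨R', args', h₁', h₂'⟩ := hgeq b' hb'
  rw [← heq, h₁] at h₁'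
  obtain ⟨rfl, h⟩ := Atom.pred.inj (Literal.pos.inj h₁')
  obtain rfl := eq_of_heq h
  exact hne (blackFact_inj.1 (h₂.symm.trans h₂'))

theorem not_computableIn_allBlackQuery [Infinite D] :
    ¬ Query.ComputableIn (allBlackQuery D) (Set.univ \ {.intermediate}) := by
  classical
  rintro ⟨P, hfrag, -, hterm, hS, hres⟩
  have hP : ¬ P.Uses .intermediate := fun h => (hfrag _ h).2 rfl
  obtain ⟨m, hm⟩ := (P.finite_rules.image fun r => r.body.card).bddAbove
  obtain ⟨a⟩ : Nonempty D := inferInstance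
  -- One leaf more than the largest body size `m`.
  obtain ⟨V, hV⟩ := Infinite.exists_subset_card_eq D (m + 1)
  have hfire : ∃ σ ∈ P.strata, ∃ r ∈ σ, ∃ ν : Valuation D,
      ∀ L ∈ r.body, L.Holds (star a V V).facts ν := by
    -- If no rule fires, the star is its own result, but it contains no fact of the output relation.
    by_contra! hcon
    have hself : P.IsResult (star a V V).facts (star a V V).facts := by
      refine isStrataResult_self (star a V V).finite fun σ hσ r hr ν hν => ?_
      obtain ⟨L, hL, hnot⟩ := hcon σ hσ r hr ν
      exact absurd (hν L hL) hnot
    have hout : outFact a ∈ {f ∈ (star a V V).facts | f.rel = relS} := by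
      rw [hres _ _ hself]
      exact outFact_mem_allBlackQuery_star (Finset.card_pos.1 (by omega))
    have hrel := (star a V V).rel_mem _ hout.1
    simp [outFact, relS, relR, relB] at hrel
  obtain ⟨σ, hσ, r, hr, ν, hν⟩ := hfire
  have hrP : r ∈ P.rules := ⟨σ, hσ, hr⟩
  have hcard : r.body.card < V.card := by
    have := hm ⟨r, hrP, rfl⟩
    simp only at this
    omega
  obtain ⟨b, hb, hνb⟩ := exists_holds_star_erase hcard hν
  obtain ⟨K, hK⟩ := hterm (star a V (V.erase b))
  have hmem := IsStrataResult.head_mem hK hσ hr (fun R args hL σ' hσ' r' hr' =>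
    Program.headRel_ne_of_neg_mem hP hrP hL ⟨σ', hσ', hr'⟩) hνb
  have hheadS : r.headRel = relS := by
    by_contra hne
    exact hP ⟨_, ⟨r, hrP, rfl⟩, _, hS, hne⟩
  have hout : (⟨r.headRel, fun i => PathExpr.eval ν (r.headArgs i)⟩ : Fact D) ∈
      {f ∈ K | f.rel = relS} := ⟨hmem, hheadS⟩
  rw [hres _ _ hK, allBlackQuery_star_eq_empty hb (Finset.notMem_erase b V)] at hout
  exact hout

/-! ### A program with an intermediate relation name -/

/-- The intermediate relation name, for the nodes with an out-neighbour that is not black. -/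
def relT : RelName := ⟨3, 1⟩

/-- The atomic variable `@n`. -/
def atomicVar (D : Type*) (n : ℕ) : Item D := .var (.atomic n)

open Classical in
/-- The rule `T(@x) ← R(@x·@y), ¬ B(@y)`. -/
noncomputable def ruleT (D : Type*) : Rule D where
  headRel := relT
  headArgs := fun _ => [atomicVar D 0]
  body := {.pos (.pred relR fun _ => [atomicVar D 0, atomicVar D 1]),
    .neg (.pred relB fun _ => [atomicVar D 1])}

open Classical in
/-- The rule `S(@x) ← R(@x·@y), ¬ T(@x)`. -/
noncomputable def ruleS (D : Type*) : Rule D where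
  headRel := relS
  headArgs := fun _ => [atomicVar D 0]
  body := {.pos (.pred relR fun _ => [atomicVar D 0, atomicVar D 1]),
    .neg (.pred relT fun _ => [atomicVar D 0])}

-- Safety, stratification and features of the program

theorem mem_ruleT_body {L : Literal D} : L ∈ (ruleT D).body ↔
    L = .pos (.pred relR fun _ => [atomicVar D 0, atomicVar D 1]) ∨
      L = .neg (.pred relB fun _ => [atomicVar D 1]) := by
  simp [ruleT]

theorem mem_ruleS_body {L : Literal D} : L ∈ (ruleS D).body ↔
    L = .pos (.pred relR fun _ => [atomicVar D 0, atomicVar D 1]) ∨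
      L = .neg (.pred relT fun _ => [atomicVar D 0]) := by
  simp [ruleS]

/-- The path expressions of the two rules consist of the atomic variables `@0` and `@1`. -/
theorem item_mem_of_mem_exprs {r : Rule D} (hr : r = ruleT D ∨ r = ruleS D) {e : PathExpr D}
    (he : e ∈ r.exprs) : ∀ t ∈ e, t = atomicVar D 0 ∨ t = atomicVar D 1 := by
  obtain ⟨A, hA, he⟩ := he
  rcases hr with rfl | rfl
  · rcases hA with rfl | ⟨L, hL, rfl⟩
    · obtain ⟨i, rfl⟩ := he
      simp [ruleT]
    · rcases mem_ruleT_body.1 hL with rfl | rfl <;> obtain ⟨i, rfl⟩ := he <;> simp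
  · rcases hA with rfl | ⟨L, hL, rfl⟩
    · obtain ⟨i, rfl⟩ := he
      simp [ruleS]
    · rcases mem_ruleS_body.1 hL with rfl | rfl <;> obtain ⟨i, rfl⟩ := he <;> simp

theorem PathExpr.exists_mem_of_mem_vars {e : PathExpr D} {x : Var} (hx : x ∈ PathExpr.vars e) :
    ∃ t ∈ e, x ∈ Item.vars t := by
  induction e with
  | nil => simp [PathExpr.vars] at hx
  | cons t e ih =>
    rw [PathExpr.vars] at hx
    rcases hx with hx | hx
    · exact ⟨t, List.mem_cons_self, hx⟩
    · obtain ⟨t', ht', hx'⟩ := ih hx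
      exact ⟨t', List.mem_cons_of_mem _ ht', hx'⟩

/-- The positive edge predicate in each body contains both variables. -/
theorem isSafe_of_eq {r : Rule D} (hr : r = ruleT D ∨ r = ruleS D) : r.IsSafe := by
  rintro x ⟨e, he, hx⟩
  obtain ⟨t, ht, hxt⟩ := PathExpr.exists_mem_of_mem_vars hx
  have hL : Literal.pos (.pred relR fun _ => [atomicVar D 0, atomicVar D 1]) ∈ r.body := by
    rcases hr with rfl | rfl
    · exact mem_ruleT_body.2 (Or.inl rfl)
    · exact mem_ruleS_body.2 (Or.inl rfl)
  refine .pred (⟨0, Nat.one_pos⟩ : Fin 1) hL ?_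
  rcases item_mem_of_mem_exprs hr he t ht with rfl | rfl <;>
    simp_all [PathExpr.vars, Item.vars, atomicVar]

/-- The program `T(@x) ← R(@x·@y), ¬ B(@y)`; `S(@x) ← R(@x·@y), ¬ T(@x)`. -/
noncomputable def allBlackProgram (D : Type*) : Program D where
  strata := [{ruleT D}, {ruleS D}]
  safe := by
    intro σ hσ r hr
    apply isSafe_of_eq
    simp only [List.mem_cons, List.not_mem_nil, or_false] at hσ
    rcases hσ with rfl | rfl <;> simp_all
  stratified := by
    intro i j hij r hr R args hL r' hr'
    -- The pair `i = 1`, `j = 0` contradicts `hij`; three cases remain.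
    fin_cases i <;> fin_cases j <;> simp at hr hr' hij <;> subst hr hr'
    · rcases mem_ruleT_body.1 hL with h | h <;> cases h; change relT ≠ relB; decide
    · rcases mem_ruleT_body.1 hL with h | h <;> cases h; change relS ≠ relB; decide
    · rcases mem_ruleS_body.1 hL with h | h <;> cases h; change relS ≠ relT; decide

theorem mem_rules_allBlackProgram {r : Rule D} :
    r ∈ (allBlackProgram D).rules ↔ r = ruleT D ∨ r = ruleS D := by
  simp [Program.rules, allBlackProgram]

theorem mem_idb_allBlackProgram {R : RelName} :
    R ∈ (allBlackProgram D).idb ↔ R = relT ∨ R = relS := by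
  constructor
  · rintro ⟨r, hr, rfl⟩
    rcases mem_rules_allBlackProgram.1 hr with rfl | rfl
    · exact Or.inl rfl
    · exact Or.inr rfl
  · rintro (rfl | rfl)
    · exact ⟨_, mem_rules_allBlackProgram.2 (Or.inl rfl), rfl⟩
    · exact ⟨_, mem_rules_allBlackProgram.2 (Or.inr rfl), rfl⟩

theorem eq_of_mem_relNames_allBlackProgram {R : RelName} (h : R ∈ (allBlackProgram D).relNames) :
    R = relR ∨ R = relB ∨ R = relT ∨ R = relS := by
  obtain ⟨r, hr, args, h | ⟨L, hL, hA⟩⟩ := h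
  · cases h
    rcases mem_rules_allBlackProgram.1 hr with rfl | rfl <;> simp [ruleT, ruleS]
  · rcases mem_rules_allBlackProgram.1 hr with rfl | rfl
    · rcases mem_ruleT_body.1 hL with rfl | rfl <;> cases hA <;> simp
    · rcases mem_ruleS_body.1 hL with rfl | rfl <;> cases hA <;> simp

theorem eq_of_dependsOn_allBlackProgram {R₁ R₂ : RelName}
    (h : (allBlackProgram D).DependsOn R₁ R₂) : R₁ = relS ∧ R₂ = relT := by
  obtain ⟨-, h₂, r, hr, rfl, L, hL, args, hA⟩ := h
  have hR₂ := mem_idb_allBlackProgram.1 h₂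
  rcases mem_rules_allBlackProgram.1 hr with rfl | rfl
  · rcases mem_ruleT_body.1 hL with rfl | rfl <;> cases hA <;> exact absurd hR₂ (by decide)
  · rcases mem_ruleS_body.1 hL with rfl | rfl <;> cases hA
    · exact absurd hR₂ (by decide)
    · exact ⟨rfl, rfl⟩

theorem allBlackProgram_inFragment :
    (allBlackProgram D).InFragment {.intermediate, .negation} := by
  intro X hX
  cases X with
  | arity =>
    obtain ⟨R, hR, hlt⟩ := hX
    rcases eq_of_mem_relNames_allBlackProgram hR with rfl | rfl | rfl | rfl <;>
      exact absurd hlt (by decide)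
  | recursion =>
    obtain ⟨R, hR⟩ := hX
    -- The only dependency edge goes from `relS` to `relT`, so the first and last edges of a cycle
    -- would force its base point to be both.
    obtain ⟨R', h, -⟩ := Relation.TransGen.head'_iff.1 hR
    obtain ⟨R'', -, h'⟩ := Relation.TransGen.tail'_iff.1 hR
    have hST := (eq_of_dependsOn_allBlackProgram h).1.symm.trans
      (eq_of_dependsOn_allBlackProgram h').2
    exact absurd hST (by decide)
  | equations =>
    obtain ⟨r, hr, L, hL, e₁, e₂, hA⟩ := hX
    rcases mem_rules_allBlackProgram.1 hr with rfl | rfl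
    · rcases mem_ruleT_body.1 hL with rfl | rfl <;> cases hA
    · rcases mem_ruleS_body.1 hL with rfl | rfl <;> cases hA
  | negation => simp
  | packing =>
    obtain ⟨r, hr, e, he, e', h⟩ := hX
    rcases item_mem_of_mem_exprs (mem_rules_allBlackProgram.1 hr) he _ h with h | h <;> cases h
  | intermediate => simp

-- Result of the program

/-- The fact `T(x)`. -/
def badFact (x : D) : Fact D := ⟨relT, fun _ => [.atom x]⟩

theorem badFact_inj {y y' : D} : badFact y = badFact y' ↔ y = y' := by
  constructor
  · intro h
    have h' := congrFun (eq_of_heq (Fact.mk.inj h).2) (⟨0, Nat.one_pos⟩ : Fin 1)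
    simpa using h'
  · rintro rfl
    rfl

theorem mem_consequences_ruleT {J : Set (Fact D)} {f : Fact D} :
    f ∈ (ruleT D).consequences J ↔
      ∃ x y, edgeFact x y ∈ J ∧ blackFact y ∉ J ∧ f = badFact x := by
  constructor
  · rintro ⟨ν, hν, rfl⟩
    exact ⟨ν.atomic 0, ν.atomic 1, hν _ (mem_ruleT_body.2 (Or.inl rfl)),
      hν _ (mem_ruleT_body.2 (Or.inr rfl)), rfl⟩
  · rintro ⟨x, y, hR, hB, rfl⟩
    -- Only `@0` and `@1` occur in the rule, so the other values are arbitrary.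
    refine ⟨⟨fun n => if n = 0 then x else y, fun _ => []⟩, fun L hL => ?_, rfl⟩
    rcases mem_ruleT_body.1 hL with rfl | rfl
    · exact hR
    · exact hB

theorem mem_consequences_ruleS {J : Set (Fact D)} {f : Fact D} :
    f ∈ (ruleS D).consequences J ↔
      ∃ x y, edgeFact x y ∈ J ∧ badFact x ∉ J ∧ f = outFact x := by
  constructor
  · rintro ⟨ν, hν, rfl⟩
    exact ⟨ν.atomic 0, ν.atomic 1, hν _ (mem_ruleS_body.2 (Or.inl rfl)),
      hν _ (mem_ruleS_body.2 (Or.inr rfl)), rfl⟩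
  · rintro ⟨x, y, hR, hT, rfl⟩
    refine ⟨⟨fun n => if n = 0 then x else y, fun _ => []⟩, fun L hL => ?_, rfl⟩
    rcases mem_ruleS_body.1 hL with rfl | rfl
    · exact hR
    · exact hT

/-- An edge fact determines its endpoints. Every consequence of either rule comes from an edge, so
this yields finiteness of both strata. -/
theorem finite_setOf_edgeFact_mem {J : Set (Fact D)} (hJ : J.Finite) :
    {p : D × D | edgeFact p.1 p.2 ∈ J}.Finite :=
  hJ.preimage fun _ _ _ _ h => Prod.ext_iff.2 (edgeFact_inj.1 h)

theorem finite_consequences_ruleT {J : Set (Fact D)} (hJ : J.Finite) :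
    ((ruleT D).consequences J).Finite := by
  refine ((finite_setOf_edgeFact_mem hJ).image fun p => badFact p.1).subset fun f hf => ?_
  obtain ⟨x, y, hR, -, rfl⟩ := mem_consequences_ruleT.1 hf
  exact ⟨(x, y), hR, rfl⟩

theorem finite_consequences_ruleS {J : Set (Fact D)} (hJ : J.Finite) :
    ((ruleS D).consequences J).Finite := by
  refine ((finite_setOf_edgeFact_mem hJ).image fun p => outFact p.1).subset fun f hf => ?_
  obtain ⟨x, y, hR, -, rfl⟩ := mem_consequences_ruleS.1 hf
  exact ⟨(x, y), hR, rfl⟩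

theorem isResult_allBlackProgram {J : Set (Fact D)} (hJ : J.Finite) :
    (allBlackProgram D).IsResult J (J ∪ (ruleT D).consequences J ∪
      (ruleS D).consequences (J ∪ (ruleT D).consequences J)) := by
  have hfin := hJ.union (finite_consequences_ruleT hJ)
  refine ⟨_, isStratumResult_singleton hJ (finite_consequences_ruleT hJ) ?_,
    _, isStratumResult_singleton hfin (finite_consequences_ruleS hfin) ?_, rfl⟩
  · intro L hL R args hA
    rcases mem_ruleT_body.1 hL with rfl | rfl <;> cases hA <;> simp [ruleT, relR, relB, relT]
  · intro L hL R args hA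
    rcases mem_ruleS_body.1 hL with rfl | rfl <;> cases hA <;> simp [ruleS, relR, relS, relT]

theorem allBlackProgram_computes : (allBlackProgram D).Computes (allBlackQuery D) := by
  refine ⟨⟨?_, ?_⟩, fun I => ⟨_, isResult_allBlackProgram I.finite⟩,
    mem_idb_allBlackProgram.2 (Or.inr rfl), ?_⟩
  · rintro R ⟨hR, hidb⟩
    rcases eq_of_mem_relNames_allBlackProgram hR with rfl | rfl | h
    · simp
    · simp
    · exact absurd (mem_idb_allBlackProgram.2 h) hidb
  · intro R hR
    rcases mem_idb_allBlackProgram.1 hR with rfl | rfl <;> decide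
  · intro I K hK
    -- Uniqueness reduces the claim to the explicit result.
    obtain rfl := IsStrataResult.unique hK (isResult_allBlackProgram I.finite)
    have hrel : ∀ f ∈ I.facts, f.rel = relR ∨ f.rel = relB := fun f hf => by
      simpa using I.rel_mem f hf
    have hedge : ∀ x y, edgeFact x y ∈ I.facts ∪ (ruleT D).consequences I.facts ↔
        edgeFact x y ∈ I.facts := by
      refine fun x y => ⟨?_, Or.inl⟩
      rintro (h | h)
      · exact h
      · obtain ⟨x', y', -, -, heq⟩ := mem_consequences_ruleT.1 h
        exact absurd (congrArg Fact.rel heq) (by change relR ≠ relT; decide)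
    have hbad : ∀ x, badFact x ∈ I.facts ∪ (ruleT D).consequences I.facts ↔
        ∃ y, edgeFact x y ∈ I.facts ∧ blackFact y ∉ I.facts := by
      intro x
      constructor
      · rintro (h | h)
        · exact absurd (hrel _ h) (by change ¬ (relT = relR ∨ relT = relB); decide)
        · obtain ⟨x', y, hR, hB, heq⟩ := mem_consequences_ruleT.1 h
          obtain rfl := badFact_inj.1 heq
          exact ⟨y, hR, hB⟩
      · rintro ⟨y, hR, hB⟩
        exact Or.inr (mem_consequences_ruleT.2 ⟨x, y, hR, hB, rfl⟩)
    ext f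
    constructor
    · rintro ⟨(h | h) | h, hf⟩
      · exact absurd (hrel f h) (by rw [hf]; decide)
      · obtain ⟨x, y, -, -, rfl⟩ := mem_consequences_ruleT.1 h
        exact absurd hf (by change relT ≠ relS; decide)
      · obtain ⟨x, y, hR, hT, rfl⟩ := mem_consequences_ruleS.1 h
        refine ⟨x, rfl, ⟨y, (hedge x y).1 hR⟩, fun z hz => ?_⟩
        by_contra hB
        exact hT ((hbad x).2 ⟨z, hz, hB⟩)
    · rintro ⟨x, rfl, ⟨y, hR⟩, hall⟩
      refine ⟨Or.inr (mem_consequences_ruleS.2 ⟨x, y, (hedge x y).2 hR, fun h => ?_, rfl⟩), rfl⟩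
      obtain ⟨z, hz, hB⟩ := (hbad x).1 h
      exact hB (hall z hz)

theorem computableIn_allBlackQuery :
    Query.ComputableIn (allBlackQuery D) {.intermediate, .negation} :=
  ⟨allBlackProgram D, allBlackProgram_inFragment, allBlackProgram_computes⟩

end SeqDatalog

theorem mainTheorem7 (D : Type*) [Countable D] [Infinite D] :
    SeqDatalog.Query.ComputableIn (SeqDatalog.allBlackQuery D) {.intermediate, .negation} ∧
    ¬ SeqDatalog.Query.ComputableIn (SeqDatalog.allBlackQuery D) (Set.univ \ {.intermediate}) ∧
    SeqDatalog.PrimitiveInPresence D .intermediate {.negation} := by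
  refine ⟨SeqDatalog.computableIn_allBlackQuery, SeqDatalog.not_computableIn_allBlackQuery,
    fun h => SeqDatalog.not_computableIn_allBlackQuery (D := D) ?_⟩
  -- The union of the two singletons in `PrimitiveInPresence` is definitionally the fragment
  -- `{.intermediate, .negation}`.
  refine h _ _ ?_ (by decide) le_rfl _ SeqDatalog.computableIn_allBlackQuery
  intro R hR
  rcases Finset.mem_insert.1 hR with rfl | hR
  · exact le_rfl
  · obtain rfl := Finset.mem_singleton.1 hR
    exact le_rfl
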